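/- Let $d\ge 1$ and let $\mathcal P$ be a homogeneous Poisson point process on $\mathbb R^d$ of intensity $\rho>0$, i.e. a random locally finite subset of $\mathbb R^d$ whose number of points in each bounded Borel set $B$ is Poisson distributed with mean $\rho|B|$ and whose numbers of points in finitely many pairwise disjoint bounded Borel sets are independent. For $\mathbf x\in\mathbb R^d$ let $$F_{\mathcal P}(\mathbf x)=\lim_{R\to\infty}\ \sum_{\mathbf z\in\mathcal P\setminus\{\mathbf x\},\ \|\mathbf x-\mathbf z\|_2<R}\frac{\mathbf x-\mathbf z}{\|\mathbf x-\mathbf z\|_2^{d}}$$ whenever this limit exists. Let $\mathbf x\neq\mathbf y$ be two points of $\mathbb R^d$. If $d\ge 3$, then almost surely the limits defining $F_{\mathcal P}(\mathbf x)$ and $F_{\mathcal P}(\mathbf y)$ both exist. Moreover (for every $d \ge 1$) the random vector $F_{\mathcal P}(\mathbf x)-F_{\mathcal P}(\mathbf y)$ is continuous, that is, for every $\mathbf c\in\mathbb R^d$, $$\mathbb P\big(F_{\mathcal P}(\mathbf x)-F_{\mathcal P}(\mathbf y)=\mathbf c\big)=0,$$ where the event is understood to require that both limits exist. -/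

import Mathlib

open MeasureTheory ProbabilityTheory Filter Topology
open scoped NNReal

/-- A configuration of `ℝ^d`: a locally finite set of points, i.e. one that has finitely many
points in every bounded set. -/
structure Configuration (d : ℕ) where
  /-- The set of points. -/
  carrier : Set (EuclideanSpace ℝ (Fin d))
  /-- Every bounded set contains finitely many points. -/
  locallyFinite : ∀ B : Set (EuclideanSpace ℝ (Fin d)), Bornology.IsBounded B →
    (carrier ∩ B).Finite

namespace Configuration

variable {d : ℕ}

/-- The number of points of the configuration in `B`, for bounded `B`. -/
noncomputable def count (X : Configuration d) (B : Set (EuclideanSpace ℝ (Fin d))) : ℕ :=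
  (X.carrier ∩ B).ncard

/-- The σ-algebra on configurations generated by the counts `X ↦ X(B)`, for `B` a bounded
Borel set. -/
noncomputable instance instMeasurableSpace : MeasurableSpace (Configuration d) :=
  ⨆ (B : Set (EuclideanSpace ℝ (Fin d))) (_ : Bornology.IsBounded B) (_ : MeasurableSet B),
    MeasurableSpace.comap (fun X : Configuration d => X.count B) ⊤

/-- The Coulomb force at `x` exerted by the points `z ≠ x` of the configuration with
`‖x - z‖ < R`. This is a finite sum, since `X` is locally finite. -/
noncomputable def partialForce (X : Configuration d) (R : ℝ) (x : EuclideanSpace ℝ (Fin d)) :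
    EuclideanSpace ℝ (Fin d) :=
  ∑ᶠ z ∈ (X.carrier \ {x}) ∩ Metric.ball x R, (‖x - z‖ ^ d)⁻¹ • (x - z)

/-- The series that defines the force at `x`, summed by increasing distance to `x`, converges. -/
def ForceConverges (X : Configuration d) (x : EuclideanSpace ℝ (Fin d)) : Prop :=
  ∃ u : EuclideanSpace ℝ (Fin d), Tendsto (fun R : ℝ => X.partialForce R x) atTop (𝓝 u)

/-- The Coulomb force `F_X(x)`: the limit of the partial forces as `R → ∞`. It is meaningful when
`X.ForceConverges x` holds. -/
noncomputable def force (X : Configuration d) (x : EuclideanSpace ℝ (Fin d)) :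
    EuclideanSpace ℝ (Fin d) :=
  limUnder atTop (fun R : ℝ => X.partialForce R x)

end Configuration

/-- `P` is a homogeneous Poisson point process on `ℝ^d` of intensity `ρ` under `μ`: a random
configuration whose counts on bounded Borel sets are Poisson of mean `ρ |B|`, and whose counts on
finitely many pairwise disjoint bounded Borel sets are independent. -/
structure IsHomogeneousPoissonProcess {d : ℕ} {Ω : Type*} [MeasurableSpace Ω] (μ : Measure Ω)
    (ρ : ℝ≥0) (P : Ω → Configuration d) : Prop where
  measurable : Measurable P
  hasLaw_count : ∀ B : Set (EuclideanSpace ℝ (Fin d)), Bornology.IsBounded B → MeasurableSet B →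
    HasLaw (fun ω => (P ω).count B) (poissonMeasure (ρ * (volume B).toNNReal)) μ
  indep_count : ∀ (n : ℕ) (B : Fin n → Set (EuclideanSpace ℝ (Fin d))),
    (∀ i, Bornology.IsBounded (B i)) → (∀ i, MeasurableSet (B i)) →
    Pairwise (fun i j => Disjoint (B i) (B j)) →
    iIndepFun (fun i ω => (P ω).count (B i)) μ

open scoped ENNReal

/-! Continuity, `d ≥ 2`. Fix a bounded Borel set `A` and suppose that it contains exactly one point
`z`. Then the force difference is a term depending only on the points outside `A`, plus `f z`, where
`f z = K (x - z) - K (y - z)` and `K` is the Coulomb kernel. The outer term is independent of the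
inside of `A`. Once it is fixed, the event forces `z` into a level set of `f`, and level sets of `f`
are Lebesgue null (`coulombKernel.volume_level_set`): on almost every line parallel to `x - y`, a
component of `f` is analytic and nonconstant. Almost surely some shell around `x` has exactly one
point, so countably many choices of `A` suffice.

Continuity, `d = 1`. The kernel has norm one, so every one-point shell makes the partial sums jump
by one; almost surely this happens infinitely often and the force does not exist.

Convergence, `d ≥ 3`. Cut space into shells of equal volume. The shell sums are independent,
centered by reflection, and have variance `O(n ^ (-2(d-1)/d))`, which is summable. They form an
`L²`-bounded martingale (`ae_exists_tendsto_sum_of_indep`), and `forceConverges_of_shells` passes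
from shell radii to all radii. -/

/-! ### Moments of the Poisson law. -/

theorem hasSum_poisson_mul_natCast (r : ℝ) :
    HasSum (fun n : ℕ => Real.exp (-r) * r ^ n / (n.factorial : ℝ) * n) r := by
  rw [← hasSum_nat_add_iff' 1]
  have h := (NormedSpace.expSeries_div_hasSum_exp r).mul_left (Real.exp (-r) * r)
  rw [← Real.exp_eq_exp_ℝ] at h
  convert! h using 1
  · ext n
    have : ((n : ℝ) + 1) ≠ 0 := by positivity
    have : (n.factorial : ℝ) ≠ 0 := by positivity
    rw [Nat.factorial_succ]
    push_cast
    field_simp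
    ring
  · rw [mul_right_comm, ← Real.exp_add]
    simp

theorem lintegral_natCast_poissonMeasure (r : ℝ≥0) :
    ∫⁻ n, (n : ℝ≥0∞) ∂poissonMeasure r = r := by
  have h := hasSum_poisson_mul_natCast r
  have hint : Integrable (fun n : ℕ => (n : ℝ)) (poissonMeasure r) := by
    rw [integrable_poissonMeasure_iff]
    simpa using h.summable
  have h2 : ∫ n : ℕ, (n : ℝ) ∂poissonMeasure r = r := by
    rw [integral_poissonMeasure]
    exact h.tsum_eq
  have h3 := ofReal_integral_eq_lintegral_ofReal hint (Eventually.of_forall fun n => by positivity)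
  rw [h2] at h3
  simpa using h3.symm

theorem integrable_natCast_sq_poissonMeasure (r : ℝ≥0) :
    Integrable (fun n : ℕ => (n : ℝ) ^ 2) (poissonMeasure r) := by
  rw [integrable_poissonMeasure_iff]
  refine Summable.of_nonneg_of_le (fun n => by positivity) (fun n => ?_)
    ((NormedSpace.expSeries_div_summable (4 * r : ℝ)).mul_left (Real.exp (-r)))
  -- Only finiteness is needed; this crude bound leads to the exponential series at `4 * r`.
  have h1 : (n : ℝ) ^ 2 ≤ 4 ^ n := by
    have : (n : ℝ) ≤ 2 ^ n := by exact_mod_cast n.lt_two_pow_self.le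
    calc (n : ℝ) ^ 2 ≤ (2 ^ n) ^ 2 := by gcongr
      _ = 4 ^ n := by rw [← pow_mul, mul_comm, pow_mul]; norm_num
  rw [Real.norm_of_nonneg (by positivity), mul_pow, mul_div_assoc, mul_div_assoc, mul_assoc,
    mul_comm ((4 : ℝ) ^ n)]
  gcongr

/-! ### Sums over the points of a configuration and their measurability. -/

namespace Configuration

variable {d : ℕ}

local notation "E" => EuclideanSpace ℝ (Fin d)

/-- The counting measure on the points of the configuration in `A`. -/
noncomputable def pointMeasure (A : Set E) (X : Configuration d) : Measure E :=
  Measure.count.restrict (X.carrier ∩ A)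

/-- The σ-algebra generated by the numbers of points in the bounded Borel subsets of `A`. -/
@[reducible]
noncomputable def localSigma (A : Set E) : MeasurableSpace (Configuration d) :=
  ⨆ B : {B : Set E // Bornology.IsBounded B ∧ MeasurableSet B ∧ B ⊆ A},
    MeasurableSpace.comap (fun X : Configuration d => X.count B.1) ⊤

/-- The sum of `f` over the points of the configuration in `A`. -/
noncomputable def pointSum {V : Type*} [AddCommMonoid V] (f : E → V) (A : Set E)
    (X : Configuration d) : V :=
  ∑ᶠ z ∈ X.carrier ∩ A, f z

theorem measurable_count_localSigma {A B : Set E} (hb : Bornology.IsBounded B)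
    (hm : MeasurableSet B) (hBA : B ⊆ A) :
    Measurable[localSigma A] (fun X : Configuration d => X.count B) := by
  rw [measurable_iff_comap_le]
  exact le_iSup (fun B : {B : Set E // Bornology.IsBounded B ∧ MeasurableSet B ∧ B ⊆ A} =>
    MeasurableSpace.comap (fun X : Configuration d => X.count B.1) ⊤) ⟨B, hb, hm, hBA⟩

theorem measurable_count {B : Set E} (hb : Bornology.IsBounded B) (hm : MeasurableSet B) :
    Measurable (fun X : Configuration d => X.count B) := by
  rw [measurable_iff_comap_le]
  exact le_iSup_of_le B (le_iSup_of_le hb (le_iSup_of_le hm le_rfl))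

theorem localSigma_le (A : Set E) : localSigma A ≤ instMeasurableSpace :=
  iSup_le fun B => (measurable_count B.2.1 B.2.2.1).comap_le

theorem localSigma_mono {A B : Set E} (h : A ⊆ B) : localSigma A ≤ localSigma B :=
  iSup_le fun C => (measurable_count_localSigma C.2.1 C.2.2.1 (C.2.2.2.trans h)).comap_le

theorem pointMeasure_apply {A s : Set E} (hA : Bornology.IsBounded A) (hs : MeasurableSet s)
    (X : Configuration d) : pointMeasure A X s = X.count (s ∩ A) := by
  have hfin := X.locallyFinite _ (hA.subset (Set.inter_subset_right (s := s)))
  have : s ∩ (X.carrier ∩ A) = X.carrier ∩ (s ∩ A) := by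
    rw [← Set.inter_assoc, Set.inter_comm s, Set.inter_assoc]
  rw [pointMeasure, Measure.restrict_apply hs, this, Measure.count_apply hfin.measurableSet, count,
    ← hfin.cast_ncard_eq]
  simp

/-- The σ-algebra knows only counts. Encoding the points as a random measure makes integrals, hence
sums over points, measurable as well. -/
theorem measurable_pointMeasure {A B : Set E} (hb : Bornology.IsBounded A) (hm : MeasurableSet A)
    (hAB : A ⊆ B) : Measurable[localSigma B] (pointMeasure A : Configuration d → Measure E) := by
  refine @Measure.measurable_of_measurable_coe _ _ _ (localSigma B) _ fun s hs => ?_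
  simp_rw [pointMeasure_apply hb hs]
  have h := measurable_count_localSigma (hb.subset Set.inter_subset_right) (hs.inter hm)
    (Set.inter_subset_right.trans hAB : s ∩ A ⊆ B)
  exact (measurable_from_top (f := fun n : ℕ => (n : ℝ≥0∞))).comp h

theorem measurable_lintegral_pointMeasure {A B : Set E} (hb : Bornology.IsBounded A)
    (hm : MeasurableSet A) (hAB : A ⊆ B) {f : E → ℝ≥0∞} (hf : Measurable f) :
    Measurable[localSigma B] (fun X : Configuration d => ∫⁻ z, f z ∂pointMeasure A X) :=
  (Measure.measurable_lintegral hf).comp (measurable_pointMeasure hb hm hAB)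

theorem pointSum_eq_sum {V : Type*} [AddCommMonoid V] (f : E → V) {A : Set E} (X : Configuration d)
    (hb : Bornology.IsBounded A) :
    pointSum f A X = ∑ z ∈ (X.locallyFinite A hb).toFinset, f z :=
  finsum_mem_eq_finite_toFinset_sum _ _

theorem lintegral_pointMeasure {A : Set E} (f : E → ℝ≥0∞) (X : Configuration d)
    (hb : Bornology.IsBounded A) : ∫⁻ z, f z ∂pointMeasure A X = pointSum f A X := by
  rw [pointSum_eq_sum f X hb, pointMeasure]
  conv_lhs => rw [← (X.locallyFinite A hb).coe_toFinset]
  rw [lintegral_finset]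
  simp

theorem pointSum_eq_toReal_sub {A : Set E} (f : E → ℝ) (X : Configuration d)
    (hb : Bornology.IsBounded A) :
    pointSum f A X = (∫⁻ z, ENNReal.ofReal (f z) ∂pointMeasure A X).toReal -
      (∫⁻ z, ENNReal.ofReal (-f z) ∂pointMeasure A X).toReal := by
  rw [lintegral_pointMeasure _ X hb, lintegral_pointMeasure _ X hb, pointSum_eq_sum _ X hb,
    pointSum_eq_sum _ X hb, pointSum_eq_sum _ X hb, ENNReal.toReal_sum (by simp),
    ENNReal.toReal_sum (by simp), ← Finset.sum_sub_distrib]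
  refine Finset.sum_congr rfl fun z _ => ?_
  rw [ENNReal.toReal_ofReal', ENNReal.toReal_ofReal']
  rcases le_total 0 (f z) with h | h <;> simp [h]

theorem measurable_pointSum {A B : Set E} (hb : Bornology.IsBounded A)
    (hm : MeasurableSet A) (hAB : A ⊆ B) {f : E → ℝ} (hf : Measurable f) :
    Measurable[localSigma B] (fun X : Configuration d => pointSum f A X) := by
  simp_rw [pointSum_eq_toReal_sub f _ hb]
  have h₁ := ENNReal.measurable_toReal.comp
    (measurable_lintegral_pointMeasure hb hm hAB hf.ennreal_ofReal)
  have h₂ := ENNReal.measurable_toReal.comp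
    (measurable_lintegral_pointMeasure hb hm hAB hf.neg.ennreal_ofReal)
  exact h₁.sub h₂

theorem pointSum_apply {A : Set E} (f : E → E) (X : Configuration d)
    (hb : Bornology.IsBounded A) (i : Fin d) :
    pointSum f A X i = pointSum (fun z => f z i) A X := by
  rw [pointSum_eq_sum _ X hb, pointSum_eq_sum _ X hb]
  simp

theorem measurable_pointSum_euclidean {A B : Set E} (hb : Bornology.IsBounded A)
    (hm : MeasurableSet A) (hAB : A ⊆ B) {f : E → E} (hf : Measurable f) :
    Measurable[localSigma B] (fun X : Configuration d => pointSum f A X) := by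
  have h : Measurable[localSigma B] (fun X : Configuration d => fun i => pointSum f A X i) := by
    refine @measurable_pi_lambda _ _ _ (localSigma B) _ _ fun i => ?_
    simp_rw [pointSum_apply f _ hb]
    exact measurable_pointSum hb hm hAB (by fun_prop)
  exact (WithLp.measurable_toLp 2 (Fin d → ℝ)).comp h

theorem pointSum_union {V : Type*} [AddCommMonoid V] (f : E → V) {A B : Set E}
    (X : Configuration d) (hA : Bornology.IsBounded A) (hB : Bornology.IsBounded B)
    (h : Disjoint A B) : pointSum f (A ∪ B) X = pointSum f A X + pointSum f B X := by
  rw [pointSum, Set.inter_union_distrib_left]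
  exact finsum_mem_union (h.mono Set.inter_subset_right Set.inter_subset_right)
    (X.locallyFinite A hA) (X.locallyFinite B hB)

theorem count_eq_card {A : Set E} (X : Configuration d) (hb : Bornology.IsBounded A) :
    X.count A = (X.locallyFinite A hb).toFinset.card :=
  Set.ncard_eq_toFinset_card _ _

theorem norm_pointSum_le {V : Type*} [SeminormedAddCommGroup V] (f : E → V) {A : Set E}
    (X : Configuration d) (hb : Bornology.IsBounded A) {C : ℝ} (hC : ∀ z ∈ A, ‖f z‖ ≤ C) :
    ‖pointSum f A X‖ ≤ X.count A * C := by
  rw [pointSum_eq_sum f X hb, count_eq_card X hb, ← nsmul_eq_mul]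
  refine (norm_sum_le _ _).trans (Finset.sum_le_card_nsmul _ _ _ fun z hz => hC z ?_)
  exact ((Set.Finite.mem_toFinset _).1 hz).2

/-- The term `z = x` is a multiple of the zero vector, so removing `x` changes nothing. -/
theorem partialForce_eq_pointSum (X : Configuration d) (R : ℝ) (x : E) :
    X.partialForce R x = pointSum (fun z => (‖x - z‖ ^ d)⁻¹ • (x - z)) (Metric.ball x R) X := by
  refine finsum_mem_inter_support_eq' _ _ _ fun z hz => ?_
  have hzx : z ≠ x := by
    rintro rfl
    simp at hz
  simp [hzx]

end Configuration

/-! ### Passage to the law on configurations, and Campbell's formula. -/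

namespace IsHomogeneousPoissonProcess

variable {d : ℕ} {ρ : ℝ≥0} {ν : Measure (Configuration d)}

local notation "E" => EuclideanSpace ℝ (Fin d)

theorem map_id {Ω : Type*} [MeasurableSpace Ω] {μ : Measure Ω}
    {P : Ω → Configuration d} (hP : IsHomogeneousPoissonProcess μ ρ P) :
    IsHomogeneousPoissonProcess (μ.map P) ρ id where
  measurable := measurable_id
  hasLaw_count B hb hm := by
    have hc := Configuration.measurable_count hb hm
    refine ⟨hc.aemeasurable, ?_⟩
    have := (hP.hasLaw_count B hb hm).map_eq
    exact (Measure.map_map hc hP.measurable).trans this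
  indep_count n B hb hm hd := by
    have h := hP.indep_count n B hb hm hd
    rw [iIndepFun_iff_measure_inter_preimage_eq_mul] at h ⊢
    intro S sets hsets
    have hm' : ∀ i ∈ S, MeasurableSet ((fun X : Configuration d => X.count (B i)) ⁻¹' sets i) :=
      fun i hi => Configuration.measurable_count (hb i) (hm i) (hsets i hi)
    simp only [id]
    rw [Measure.map_apply hP.measurable (Finset.measurableSet_biInter _ hm')]
    rw [Finset.prod_congr rfl fun i hi => Measure.map_apply hP.measurable (hm' i hi)]
    simp only [Set.preimage_iInter]
    exact h S hsets

theorem lintegral_count (h : IsHomogeneousPoissonProcess ν ρ id) {B : Set E}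
    (hb : Bornology.IsBounded B) (hm : MeasurableSet B) :
    ∫⁻ X, (X.count B : ℝ≥0∞) ∂ν = ρ * volume B := by
  have := (h.hasLaw_count B hb hm).lintegral_comp (f := fun n : ℕ => (n : ℝ≥0∞))
    measurable_from_top.aemeasurable
  simp only [id] at this
  rw [this, lintegral_natCast_poissonMeasure, ENNReal.coe_mul,
    ENNReal.coe_toNNReal hb.measure_lt_top.ne]

/-- Campbell's formula: averaging the point measures gives `ρ` times Lebesgue measure on `A`, as the
mean counts show. -/
theorem lintegral_lintegral_pointMeasure (h : IsHomogeneousPoissonProcess ν ρ id) {A : Set E}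
    (hb : Bornology.IsBounded A) (hm : MeasurableSet A) {f : E → ℝ≥0∞} (hf : Measurable f) :
    ∫⁻ X, ∫⁻ z, f z ∂Configuration.pointMeasure A X ∂ν = ρ * ∫⁻ z in A, f z := by
  have hmeas : Measurable (Configuration.pointMeasure A : Configuration d → Measure E) :=
    (Configuration.measurable_pointMeasure hb hm subset_rfl).mono
      (Configuration.localSigma_le A) le_rfl
  have hbind : ν.bind (Configuration.pointMeasure A) = (ρ : ℝ≥0∞) • volume.restrict A := by
    ext s hs
    rw [Measure.bind_apply hs hmeas.aemeasurable]
    simp_rw [Configuration.pointMeasure_apply hb hs]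
    rw [h.lintegral_count (hb.subset Set.inter_subset_right) (hs.inter hm), Measure.smul_apply,
      Measure.restrict_apply hs, smul_eq_mul]
  rw [← Measure.lintegral_bind hmeas.aemeasurable hf.aemeasurable, hbind, lintegral_smul_measure,
    smul_eq_mul]

end IsHomogeneousPoissonProcess

/-! ### Independence over disjoint regions. -/

namespace Configuration

variable {d : ℕ}

local notation "E" => EuclideanSpace ℝ (Fin d)

/-- The points of the union of the finite family `B` whose membership pattern is `u`. -/
def atom {κ : Type*} (B : κ → Set E) (u : κ → Prop) : Set E :=
  {z | (fun k => z ∈ B k) = u} ∩ ⋃ k, B k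

theorem disjoint_atom {κ : Type*} {B : κ → Set E} {u v : κ → Prop} (h : u ≠ v) :
    Disjoint (atom B u) (atom B v) := by
  refine Set.disjoint_left.2 fun z hz hz' => h ?_
  exact hz.1.symm.trans hz'.1

section Atom

variable {κ : Type*} [Finite κ] {B : κ → Set (EuclideanSpace ℝ (Fin d))}

theorem measurableSet_pattern (hm : ∀ k, MeasurableSet (B k)) (u : κ → Prop) :
    MeasurableSet {z | (fun k => z ∈ B k) = u} := by
  have h : Measurable (fun z => fun k => z ∈ B k) :=
    measurable_pi_lambda _ fun k => measurableSet_setOfPred.1 (hm k)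
  exact h (measurableSet_singleton u)

theorem measurableSet_atom (hm : ∀ k, MeasurableSet (B k)) (u : κ → Prop) :
    MeasurableSet (atom B u) :=
  (measurableSet_pattern hm u).inter (MeasurableSet.iUnion hm)

/-- Intersecting with the union matters for the pattern that is false everywhere, whose fibre is the
unbounded complement of the union. -/
theorem isBounded_atom (hb : ∀ k, Bornology.IsBounded (B k)) (u : κ → Prop) :
    Bornology.IsBounded (atom B u) :=
  ((Bornology.isBounded_iUnion).2 hb).subset Set.inter_subset_right

theorem count_eq_sum_atom [Fintype (κ → Prop)] (hb : ∀ k, Bornology.IsBounded (B k))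
    (hm : ∀ k, MeasurableSet (B k)) (k : κ) [DecidablePred fun u : κ → Prop => u k]
    (X : Configuration d) :
    X.count (B k) = ∑ u : κ → Prop with u k, X.count (atom B u) := by
  have h := sum_measure_preimage_singleton (μ := pointMeasure (B k) X)
    (f := fun z => fun k => z ∈ B k) Finset.univ (fun u _ => measurableSet_pattern hm u)
  rw [Finset.coe_univ, Set.preimage_univ, pointMeasure_apply (hb k) .univ, Set.univ_inter] at h
  rw [← Nat.cast_inj (R := ℝ≥0∞), ← h, Finset.sum_filter]
  push_cast
  refine Finset.sum_congr rfl fun u _ => ?_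
  rw [pointMeasure_apply (s := _ ⁻¹' {u}) (hb k) (measurableSet_pattern hm u)]
  split_ifs with hu
  · congr 2
    ext z
    simp only [atom, Set.mem_inter_iff, Set.mem_preimage, Set.mem_singleton_iff, Set.mem_ofPred_eq,
      Set.mem_iUnion]
    refine and_congr_right fun hz => ⟨fun h => ⟨k, h⟩, fun _ => ?_⟩
    rw [← hz] at hu
    exact hu
  · have : (fun z => fun k => z ∈ B k) ⁻¹' {u} ∩ B k = ∅ := by
      ext z
      simp only [Set.mem_inter_iff, Set.mem_preimage, Set.mem_singleton_iff,
        Set.mem_empty_iff_false, iff_false, not_and]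
      rintro rfl
      exact hu
    rw [this]
    simp [count]

end Atom

end Configuration

namespace IsHomogeneousPoissonProcess

open Configuration

variable {d : ℕ} {ρ : ℝ≥0} {ν : Measure (Configuration d)}

local notation "E" => EuclideanSpace ℝ (Fin d)

theorem iIndepFun_count (h : IsHomogeneousPoissonProcess ν ρ id) {ι : Type*} [Finite ι]
    {B : ι → Set E} (hb : ∀ i, Bornology.IsBounded (B i)) (hm : ∀ i, MeasurableSet (B i))
    (hd : Pairwise fun i j => Disjoint (B i) (B j)) :
    iIndepFun (fun i (X : Configuration d) => X.count (B i)) ν := by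
  obtain ⟨n, ⟨e⟩⟩ := Finite.exists_equiv_fin ι
  have := h.indep_count n (fun i => B (e.symm i)) (fun i => hb _) (fun i => hm _)
    (fun i j hij => hd (e.symm.injective.ne hij))
  simpa [Function.comp_def] using this.precomp e.injective

/-- Sets within one family may overlap, so the defining independence does not apply directly. The
atoms of both families are pairwise disjoint, and every count is a sum of counts of atoms of its own
family. -/
theorem indep_iSup_count (h : IsHomogeneousPoissonProcess ν ρ id) {κ κ' : Type*} [Finite κ]
    [Finite κ'] {B : κ → Set E} {C : κ' → Set E} (hb : ∀ i, Bornology.IsBounded (B i))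
    (hm : ∀ i, MeasurableSet (B i)) (hb' : ∀ i, Bornology.IsBounded (C i))
    (hm' : ∀ i, MeasurableSet (C i)) (hd : ∀ i j, Disjoint (B i) (C j)) :
    Indep (⨆ i, MeasurableSpace.comap (fun X : Configuration d => X.count (B i)) ⊤)
      (⨆ i, MeasurableSpace.comap (fun X : Configuration d => X.count (C i)) ⊤) ν := by
  classical
  have : Fintype (κ → Prop) := Fintype.ofFinite _
  have : Fintype (κ' → Prop) := Fintype.ofFinite _
  let D : (κ → Prop) ⊕ (κ' → Prop) → Set E := Sum.elim (atom B) (atom C)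
  have hDb : ∀ i, Bornology.IsBounded (D i) := by
    rintro (u | u)
    exacts [isBounded_atom hb u, isBounded_atom hb' u]
  have hDm : ∀ i, MeasurableSet (D i) := by
    rintro (u | u)
    exacts [measurableSet_atom hm u, measurableSet_atom hm' u]
  have hBC : Disjoint (⋃ i, B i) (⋃ i, C i) := by
    simp only [Set.disjoint_iUnion_left, Set.disjoint_iUnion_right]
    exact fun i j => hd j i
  have hDd : Pairwise fun i j => Disjoint (D i) (D j) := by
    rintro (u | u) (v | v) huv
    · exact disjoint_atom (fun h => huv (congrArg _ h))
    · exact hBC.mono Set.inter_subset_right Set.inter_subset_right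
    · exact hBC.symm.mono Set.inter_subset_right Set.inter_subset_right
    · exact disjoint_atom (fun h => huv (congrArg _ h))
  have hind := h.iIndepFun_count hDb hDm hDd
  rw [iIndepFun_iff_iIndep] at hind
  have key := indep_iSup_of_disjoint (fun i => (measurable_count (hDb i) (hDm i)).comap_le) hind
    (S := Set.range Sum.inl) (T := Set.range Sum.inr) Set.isCompl_range_inl_range_inr.disjoint
  refine indep_of_indep_of_le_left (indep_of_indep_of_le_right key ?_) ?_
  · refine iSup_le fun k => ?_
    rw [← measurable_iff_comap_le]
    simp_rw [count_eq_sum_atom hb' hm' k]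
    refine Finset.measurable_fun_sum _ fun u _ => ?_
    rw [measurable_iff_comap_le]
    exact le_iSup₂_of_le (Sum.inr u) ⟨u, rfl⟩ le_rfl
  · refine iSup_le fun k => ?_
    rw [← measurable_iff_comap_le]
    simp_rw [count_eq_sum_atom hb hm k]
    refine Finset.measurable_fun_sum _ fun u _ => ?_
    rw [measurable_iff_comap_le]
    exact le_iSup₂_of_le (Sum.inl u) ⟨u, rfl⟩ le_rfl

/-- Each local σ-algebra is the directed supremum of those generated by finitely many counts, and
independence passes to directed suprema, one side at a time. -/
theorem indep_localSigma (h : IsHomogeneousPoissonProcess ν ρ id) [IsProbabilityMeasure ν]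
    {A B : Set E} (hAB : Disjoint A B) : Indep (localSigma A) (localSigma B) ν := by
  have directed : ∀ A : Set E, ∃ m : Finset {B : Set E // Bornology.IsBounded B ∧
      MeasurableSet B ∧ B ⊆ A} → MeasurableSpace (Configuration d),
      (m = fun s => ⨆ B : {B // B ∈ s},
        MeasurableSpace.comap (fun X : Configuration d => X.count B.1.1) ⊤) ∧
      Directed (· ≤ ·) m ∧ localSigma A = ⨆ s, m s ∧ ∀ s, m s ≤ instMeasurableSpace := by
    classical
    intro A
    have mono : Monotone (fun s : Finset {B : Set E // Bornology.IsBounded B ∧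
        MeasurableSet B ∧ B ⊆ A} =>
        ⨆ B : {B // B ∈ s},
          MeasurableSpace.comap (fun X : Configuration d => X.count B.1.1) ⊤) :=
      fun s t hst => iSup_le fun B => le_iSup_of_le ⟨B.1, hst B.2⟩ le_rfl
    refine ⟨_, rfl, mono.directed_le, le_antisymm ?_ ?_, fun s => ?_⟩
    · exact iSup_le fun B => le_iSup_of_le {B} (le_iSup_of_le ⟨B, by simp⟩ le_rfl)
    · exact iSup_le fun s => iSup_le fun B => le_iSup_of_le B.1 le_rfl
    · exact iSup_le fun B => (measurable_count B.1.2.1 B.1.2.2.1).comap_le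
  obtain ⟨m₁, rfl, hdir₁, heq₁, hle₁⟩ := directed A
  obtain ⟨m₂, rfl, hdir₂, heq₂, hle₂⟩ := directed B
  rw [heq₁]
  refine indep_iSup_of_directed_le (fun s => ?_) hle₁ (localSigma_le B) hdir₁
  rw [heq₂]
  refine (indep_iSup_of_directed_le (fun t => ?_) hle₂ (hle₁ s) hdir₂).symm
  exact h.indep_iSup_count (fun B => B.1.2.1) (fun B => B.1.2.2.1) (fun B => B.1.2.1)
    (fun B => B.1.2.2.1) (fun B C => hAB.symm.mono B.1.2.2.2 C.1.2.2.2)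

end IsHomogeneousPoissonProcess

/-! ### Infinitely many cells with exactly one point. -/

namespace IsHomogeneousPoissonProcess

open Configuration

variable {d : ℕ} {ρ : ℝ≥0} {ν : Measure (Configuration d)}

local notation "E" => EuclideanSpace ℝ (Fin d)

/-- Second Borel–Cantelli lemma: the events are independent and share one positive probability. -/
theorem ae_frequently_count_eq_one (h : IsHomogeneousPoissonProcess ν ρ id)
    [IsProbabilityMeasure ν] (hρ : 0 < ρ) {A : ℕ → Set E} (hb : ∀ n, Bornology.IsBounded (A n))
    (hm : ∀ n, MeasurableSet (A n)) (hd : Pairwise fun i j => Disjoint (A i) (A j))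
    (hv : ∀ n, volume (A n) = volume (A 0)) (hv0 : volume (A 0) ≠ 0) :
    ∀ᵐ X ∂ν, ∃ᶠ n in atTop, X.count (A n) = 1 := by
  have hind : iIndepFun (fun n (X : Configuration d) => X.count (A n)) ν := by
    rw [iIndepFun_iff_finset]
    exact fun s => h.iIndepFun_count (ι := s) (fun i => hb i) (fun i => hm i)
      (fun i j hij => hd (Subtype.coe_injective.ne hij))
  have hset : ∀ n, MeasurableSet {X : Configuration d | X.count (A n) = 1} := fun n =>
    measurable_count (hb n) (hm n) (measurableSet_singleton 1)
  have hprob : ∀ n, ν {X : Configuration d | X.count (A n) = 1} =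
      poissonMeasure (ρ * (volume (A 0)).toNNReal) {1} := by
    intro n
    rw [← hv n, ← (h.hasLaw_count _ (hb n) (hm n)).map_eq]
    exact (Measure.map_apply (measurable_count (hb n) (hm n)) (measurableSet_singleton 1)).symm
  have hiset : iIndepSet (fun n => {X : Configuration d | X.count (A n) = 1}) ν := by
    rw [iIndepSet_iff_meas_biInter hset]
    intro s
    exact (iIndepFun_iff_measure_inter_preimage_eq_mul.1 hind) s (sets := fun _ => {1})
      fun i _ => measurableSet_singleton 1
  have hpos : poissonMeasure (ρ * (volume (A 0)).toNNReal) {1} ≠ 0 := by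
    have hr : 0 < ρ * (volume (A 0)).toNNReal :=
      mul_pos hρ (ENNReal.toNNReal_pos hv0 (hb 0).measure_lt_top.ne)
    exact fun h0 => (poissonMeasure_real_singleton_pos 1 hr).ne' (by simp [measureReal_def, h0])
  have key := measure_limsup_eq_one hset hiset (by
    simp_rw [hprob]
    exact ENNReal.tsum_const_eq_top_of_ne_zero hpos)
  have hlim : MeasurableSet (limsup (fun n => {X : Configuration d | X.count (A n) = 1}) atTop) :=
    MeasurableSet.measurableSet_limsup hset
  rw [← mem_ae_iff_prob_eq_one hlim] at key
  filter_upwards [key] with X hX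
  rwa [mem_limsup_iff_frequently_mem] at hX

end IsHomogeneousPoissonProcess

/-! ### The Coulomb kernel and the level sets of its differences. -/

/-- The Coulomb kernel `v / ‖v‖ ^ d` on `ℝ^d`. -/
noncomputable def coulombKernel (d : ℕ) (v : EuclideanSpace ℝ (Fin d)) :
    EuclideanSpace ℝ (Fin d) :=
  (‖v‖ ^ d)⁻¹ • v

namespace coulombKernel

variable {d : ℕ}

theorem measurable : Measurable (coulombKernel d) := by
  unfold coulombKernel
  fun_prop

theorem norm_eq (hd : 1 ≤ d) (v : EuclideanSpace ℝ (Fin d)) (hv : v ≠ 0) :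
    ‖coulombKernel d v‖ = (‖v‖ ^ (d - 1))⁻¹ := by
  have : ‖v‖ ≠ 0 := norm_ne_zero_iff.2 hv
  obtain ⟨n, rfl⟩ := Nat.exists_eq_add_of_le' hd
  rw [coulombKernel, norm_smul, norm_inv, norm_pow, norm_norm, Nat.add_sub_cancel, pow_succ]
  field_simp

theorem neg (v : EuclideanSpace ℝ (Fin d)) : coulombKernel d (-v) = -coulombKernel d v := by
  simp [coulombKernel]

theorem tendsto_cobounded (hd : 2 ≤ d) :
    Tendsto (coulombKernel d) (Bornology.cobounded _) (𝓝 0) := by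
  rw [tendsto_zero_iff_norm_tendsto_zero]
  have h : Tendsto (fun v : EuclideanSpace ℝ (Fin d) => (‖v‖ ^ (d - 1))⁻¹)
      (Bornology.cobounded _) (𝓝 0) :=
    ((tendsto_pow_atTop (by omega)).comp tendsto_norm_cobounded_atTop).inv_tendsto_atTop
  refine h.congr' ?_
  filter_upwards [Bornology.eventually_ne_cobounded 0] with v hv
  exact (norm_eq (by omega) v hv).symm

theorem analyticAt_inner_line (e u : EuclideanSpace ℝ (Fin d)) {s : ℝ} (h : u - s • e ≠ 0) :
    AnalyticAt ℝ (fun s : ℝ => inner ℝ e (coulombKernel d (u - s • e))) s := by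
  -- The smoothness exponent `⊤` means analytic here.
  have h1 : ContDiffAt ℝ ⊤ (fun s : ℝ => u - s • e) s := by fun_prop
  have h2 : ContDiffAt ℝ ⊤ (fun s : ℝ => ‖u - s • e‖) s := h1.norm ℝ h
  have h3 : ContDiffAt ℝ ⊤ (fun s : ℝ => (‖u - s • e‖ ^ d)⁻¹) s :=
    (h2.pow d).inv (pow_ne_zero _ (norm_ne_zero_iff.2 h))
  exact (contDiffAt_const.inner ℝ (h3.smul h1)).analyticAt

theorem tendsto_inner_line (hd : 2 ≤ d) {e : EuclideanSpace ℝ (Fin d)} (he : e ≠ 0)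
    (u : EuclideanSpace ℝ (Fin d)) :
    Tendsto (fun s : ℝ => inner ℝ e (coulombKernel d (u - s • e))) atTop (𝓝 0) := by
  have h : Tendsto (fun s : ℝ => u - s • e) atTop (Bornology.cobounded _) := by
    have h1 : Tendsto (fun s : ℝ => s • e) atTop (Bornology.cobounded _) := by
      rw [← tendsto_norm_atTop_iff_cobounded]
      simp_rw [norm_smul]
      exact tendsto_norm_atTop_atTop.atTop_mul_const (norm_pos_iff.2 he)
    rw [← tendsto_norm_atTop_iff_cobounded] at h1 ⊢
    refine tendsto_atTop_mono (fun s => ?_) (tendsto_atTop_add_const_right _ (-‖u‖) h1)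
    have := norm_sub_norm_le (s • e) u
    rw [norm_sub_rev] at this
    linarith
  simpa using (tendsto_const_nhds (x := e)).inner (𝕜 := ℝ) ((tendsto_cobounded hd).comp h)

/-- Otherwise decay at infinity forces `c = 0`, so the component along `e` is 1-periodic and tends
to zero, hence vanishes. Then `e` is orthogonal to the whole line, contradicting `e ≠ 0`. -/
theorem exists_inner_line_sub_ne (hd : 2 ≤ d) {e : EuclideanSpace ℝ (Fin d)} (he : e ≠ 0)
    (u : EuclideanSpace ℝ (Fin d)) (h : ∀ s : ℝ, u - s • e ≠ 0) (c : ℝ) :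
    ∃ t : ℝ, inner ℝ e (coulombKernel d (u - t • e)) -
      inner ℝ e (coulombKernel d (u - (t + 1) • e)) - c ≠ 0 := by
  by_contra! hall
  set k : ℝ → ℝ := fun s => inner ℝ e (coulombKernel d (u - s • e)) with hk
  have hlim : Tendsto k atTop (𝓝 0) := tendsto_inner_line hd he u
  have hc : c = 0 := by
    have h1 : Tendsto (fun t => k t - k (t + 1)) atTop (𝓝 (0 - 0)) :=
      hlim.sub (hlim.comp (tendsto_atTop_add_const_right _ 1 tendsto_id))
    have h2 : (fun t => k t - k (t + 1)) = fun _ => c := by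
      ext t
      linarith [hall t]
    rw [h2, sub_zero] at h1
    exact tendsto_nhds_unique tendsto_const_nhds h1
  have hper : ∀ t, ∀ n : ℕ, k (t + n) = k t := by
    intro t n
    induction n with
    | zero => simp
    | succ n ih =>
      have := hall (t + n)
      push_cast
      rw [← ih, ← add_assoc]
      change k (t + n) - k (t + n + 1) - c = 0 at this
      linarith
  have hzero : ∀ t, k t = 0 := by
    intro t
    have h1 : Tendsto (fun n : ℕ => k (t + n)) atTop (𝓝 0) :=
      hlim.comp (tendsto_atTop_add_const_left _ t tendsto_natCast_atTop_atTop)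
    simp_rw [hper t] at h1
    exact tendsto_nhds_unique tendsto_const_nhds h1
  have horth : ∀ t : ℝ, inner ℝ e (u - t • e) = 0 := by
    intro t
    have h1 := hzero t
    simp only [hk, coulombKernel, inner_smul_right] at h1
    have h2 : (‖u - t • e‖ ^ d)⁻¹ ≠ 0 := inv_ne_zero (pow_ne_zero _ (norm_ne_zero_iff.2 (h t)))
    exact (mul_eq_zero.1 h1).resolve_left h2
  have h0 := horth 0
  have h1 := horth 1
  rw [zero_smul, sub_zero] at h0
  rw [one_smul, inner_sub_right, h0, zero_sub, neg_eq_zero] at h1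
  exact he (inner_self_eq_zero.1 h1)

theorem volume_level_set (hd : 2 ≤ d) {x y : EuclideanSpace ℝ (Fin d)} (hxy : x ≠ y)
    (w : EuclideanSpace ℝ (Fin d)) :
    volume {z | coulombKernel d (x - z) - coulombKernel d (y - z) = w} = 0 := by
  have he : x - y ≠ 0 := sub_ne_zero.2 hxy
  set e := x - y with hedef
  have hmeas : MeasurableSet {z | coulombKernel d (x - z) - coulombKernel d (y - z) ≠ w} := by
    have h1 : Measurable fun z => coulombKernel d (x - z) - coulombKernel d (y - z) :=
      (measurable.comp (measurable_const.sub measurable_id)).sub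
        (measurable.comp (measurable_const.sub measurable_id))
    exact (h1 (measurableSet_singleton w)).compl
  -- The line through `x` and `y` carries the singularities; it is null because `d ≥ 2`.
  have hline : ∀ᵐ z ∂(volume : Measure (EuclideanSpace ℝ (Fin d))),
      z ∉ AffineSubspace.mk' x (Submodule.span ℝ {e}) := by
    refine measure_eq_zero_iff_ae_notMem.1 (Measure.addHaar_affineSubspace volume _ fun htop => ?_)
    have h1 := congrArg AffineSubspace.direction htop
    rw [AffineSubspace.direction_mk', AffineSubspace.direction_top] at h1
    have h2 := finrank_span_singleton (K := ℝ) he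
    rw [h1, finrank_top, finrank_euclideanSpace_fin] at h2
    omega
  rw [measure_eq_zero_iff_ae_notMem]
  -- Fubini: it suffices to treat almost every point of almost every line parallel to `e`.
  refine (ae_ae_add_linearMap_mem_iff (LinearMap.toSpanSingleton ℝ _ e) volume volume hmeas).1 ?_
  filter_upwards [hline] with z hz
  have hne : ∀ s : ℝ, (x - z) - s • e ≠ 0 := by
    intro s hs
    refine hz ?_
    rw [AffineSubspace.mem_mk', vsub_eq_sub, Submodule.mem_span_singleton]
    refine ⟨-s, ?_⟩
    rw [neg_smul, ← sub_eq_zero.1 hs, neg_sub]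
  have han : AnalyticOnNhd ℝ (fun t : ℝ => inner ℝ e (coulombKernel d ((x - z) - t • e)) -
      inner ℝ e (coulombKernel d ((x - z) - (t + 1) • e)) - inner ℝ e w) Set.univ := by
    intro t _
    have h2 : AnalyticAt ℝ (fun t : ℝ => t + 1) t := analyticAt_id.add analyticAt_const
    have h3 := (analyticAt_inner_line e _ (hne (t + 1))).comp_of_eq h2 rfl
    exact ((analyticAt_inner_line e _ (hne t)).sub h3).sub analyticAt_const
  obtain ⟨t₀, ht₀⟩ := exists_inner_line_sub_ne hd he (x - z) hne (inner ℝ e w)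
  have hcod := han.preimage_zero_mem_codiscrete ht₀
  have hae := ae_restrict_le_codiscreteWithin (μ := (volume : Measure ℝ)) MeasurableSet.univ hcod
  rw [Measure.restrict_univ] at hae
  filter_upwards [hae] with t ht heq
  refine ht ?_
  rw [LinearMap.toSpanSingleton_apply] at heq
  have h1 : x - (z + t • e) = (x - z) - t • e := by abel
  -- Since `y = x - e`, the second kernel is the first one with `t` shifted by one.
  have h2 : y - (z + t • e) = (x - z) - (t + 1) • e := by
    rw [add_smul, one_smul, hedef]
    abel
  rw [h1, h2] at heq
  simp only [Set.mem_singleton_iff]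
  rw [← heq, inner_sub_right, sub_self]

end coulombKernel

/-! ### Shells of equal volume. -/

/-- Radii of concentric balls in `ℝ^d` whose volumes increase by constant steps. -/
noncomputable def shellRadius (d n : ℕ) : ℝ := ((n : ℝ) + 1) ^ (d : ℝ)⁻¹

/-- The spherical shells around `x` cut out by the radii `shellRadius d n`. -/
def shell {d : ℕ} (x : EuclideanSpace ℝ (Fin d)) (n : ℕ) : Set (EuclideanSpace ℝ (Fin d)) :=
  (fun z => dist z x) ⁻¹' Set.Ico (shellRadius d n) (shellRadius d (n + 1))

section Shell

variable {d : ℕ}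

theorem shellRadius_pow (hd : d ≠ 0) (n : ℕ) : shellRadius d n ^ d = n + 1 :=
  Real.rpow_inv_natCast_pow (by positivity) hd

/-- The shells start at radius one, away from the singularity of the kernel. -/
theorem shellRadius_pos (n : ℕ) : 0 < shellRadius d n := by
  unfold shellRadius
  positivity

theorem shellRadius_mono : Monotone (shellRadius d) := fun m n hmn =>
  Real.rpow_le_rpow (by positivity) (by gcongr) (by positivity)

theorem tendsto_shellRadius (hd : d ≠ 0) : Tendsto (shellRadius d) atTop atTop :=
  (tendsto_rpow_atTop (by positivity)).comp
    (tendsto_atTop_add_const_right _ _ tendsto_natCast_atTop_atTop)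

variable (x : EuclideanSpace ℝ (Fin d))

theorem shell_subset_ball (n : ℕ) : shell x n ⊆ Metric.ball x (shellRadius d (n + 1)) :=
  fun _ hz => hz.2

theorem isBounded_shell (n : ℕ) : Bornology.IsBounded (shell x n) :=
  Metric.isBounded_ball.subset (shell_subset_ball x n)

theorem measurableSet_shell (n : ℕ) : MeasurableSet (shell x n) :=
  (measurable_id.dist measurable_const) measurableSet_Ico

theorem pairwise_disjoint_shell : Pairwise fun i j => Disjoint (shell x i) (shell x j) :=
  fun _ _ hij => (shellRadius_mono.pairwise_disjoint_on_Ico_succ hij).preimage _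

theorem ball_union_shell (n : ℕ) : Metric.ball x (shellRadius d n) ∪ shell x n =
    Metric.ball x (shellRadius d (n + 1)) := by
  ext z
  have := shellRadius_mono (d := d) n.le_succ
  simp only [Set.mem_union, Metric.mem_ball, shell, Set.mem_preimage, Set.mem_Ico]
  grind

theorem disjoint_ball_shell (n : ℕ) : Disjoint (Metric.ball x (shellRadius d n)) (shell x n) :=
  Set.disjoint_left.2 fun _ hz hz' => hz'.1.not_gt hz

theorem volume_shell (hd : d ≠ 0) (n : ℕ) :
    volume (shell x n) = volume (Metric.ball (0 : EuclideanSpace ℝ (Fin d)) 1) := by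
  have : Nonempty (Fin d) := ⟨⟨0, Nat.pos_of_ne_zero hd⟩⟩
  have hball : ∀ n, volume (Metric.ball x (shellRadius d n)) =
      (n + 1) * volume (Metric.ball (0 : EuclideanSpace ℝ (Fin d)) 1) := by
    intro n
    rw [Measure.addHaar_ball _ _ (shellRadius_pos n).le, finrank_euclideanSpace_fin,
      shellRadius_pow hd, ENNReal.ofReal_add (by positivity) zero_le_one]
    simp
  have h := measure_union (μ := volume) (disjoint_ball_shell x n) (measurableSet_shell x n)
  rw [ball_union_shell, hball, hball] at h
  push_cast at h
  rw [add_mul (_ + 1 : ℝ≥0∞), one_mul] at h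
  refine ((ENNReal.add_right_inj ?_).1 h).symm
  exact ENNReal.mul_ne_top (by simp) measure_ball_lt_top.ne

end Shell

namespace IsHomogeneousPoissonProcess

open Configuration

variable {d : ℕ} {ρ : ℝ≥0} {ν : Measure (Configuration d)}

local notation "E" => EuclideanSpace ℝ (Fin d)

theorem ae_frequently_count_shell_eq_one (h : IsHomogeneousPoissonProcess ν ρ id)
    [IsProbabilityMeasure ν] (hρ : 0 < ρ) (hd : d ≠ 0) (x : E) :
    ∀ᵐ X ∂ν, ∃ᶠ n in atTop, X.count (shell x n) = 1 := by
  refine h.ae_frequently_count_eq_one hρ (isBounded_shell x) (measurableSet_shell x)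
    (pairwise_disjoint_shell x) (fun n => ?_) ?_
  · rw [volume_shell x hd, volume_shell x hd]
  · rw [volume_shell x hd]
    exact (Metric.measure_ball_pos _ _ one_pos).ne'

theorem ae_count_eq_zero (h : IsHomogeneousPoissonProcess ν ρ id) {B : Set E}
    (hb : Bornology.IsBounded B) (hm : MeasurableSet B) (h0 : volume B = 0) :
    ∀ᵐ X ∂ν, X.count B = 0 := by
  have h1 := h.lintegral_count hb hm
  have hmeas : Measurable fun X : Configuration d => (X.count B : ℝ≥0∞) :=
    (measurable_from_top (f := fun n : ℕ => (n : ℝ≥0∞))).comp (measurable_count hb hm)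
  rw [h0, mul_zero, lintegral_eq_zero_iff hmeas] at h1
  filter_upwards [h1] with X hX
  simpa using hX

end IsHomogeneousPoissonProcess

/-! ### Divergence in dimension one, and the force difference split into inner and outer parts. -/

namespace Configuration

variable {d : ℕ}

local notation "E" => EuclideanSpace ℝ (Fin d)

theorem exists_of_count_eq_one {X : Configuration d} {A : Set E} (h : X.count A = 1) :
    ∃ z, X.carrier ∩ A = {z} :=
  Set.ncard_eq_one.1 h

theorem pointSum_of_inter_eq_singleton {V : Type*} [AddCommMonoid V] (f : E → V)
    {X : Configuration d} {A : Set E} {z : E} (h : X.carrier ∩ A = {z}) :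
    pointSum f A X = f z := by
  rw [pointSum, h, finsum_mem_singleton]

theorem partialForce_shell (X : Configuration d) (x : E) (n : ℕ) :
    X.partialForce (shellRadius d (n + 1)) x =
      X.partialForce (shellRadius d n) x + pointSum (fun z => coulombKernel d (x - z))
        (shell x n) X := by
  rw [partialForce_eq_pointSum, partialForce_eq_pointSum, ← ball_union_shell,
    pointSum_union _ _ Metric.isBounded_ball (isBounded_shell x n) (disjoint_ball_shell x n)]
  rfl

theorem not_forceConverges_of_frequently (X : Configuration 1) (x : EuclideanSpace ℝ (Fin 1))
    (h : ∃ᶠ n in atTop, X.count (shell x n) = 1) : ¬ X.ForceConverges x := by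
  rintro ⟨u, hu⟩
  have h1 := hu.comp (tendsto_shellRadius one_ne_zero)
  have h2 := ((tendsto_add_atTop_iff_nat 1).2 h1).sub h1
  rw [sub_self] at h2
  have h3 : ∀ᶠ n in atTop, ‖X.partialForce (shellRadius 1 (n + 1)) x -
      X.partialForce (shellRadius 1 n) x‖ < 1 := by
    simpa using h2.norm.eventually_lt_const (by simp : ‖(0 : EuclideanSpace ℝ (Fin 1))‖ < 1)
  obtain ⟨n, hn, hn'⟩ := (h.and_eventually h3).exists
  obtain ⟨z, hz⟩ := exists_of_count_eq_one hn
  rw [partialForce_shell, add_sub_cancel_left, pointSum_of_inter_eq_singleton _ hz] at hn'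
  have hzs : z ∈ shell x n := (hz ▸ Set.mem_singleton z : z ∈ X.carrier ∩ shell x n).2
  have hzx : x - z ≠ 0 := by
    rw [sub_ne_zero]
    rintro rfl
    exact (shellRadius_pos n).not_ge (hzs.1.trans (dist_self x).le)
  rw [coulombKernel.norm_eq le_rfl _ hzx] at hn'
  simp at hn'

theorem pointSum_sub {V : Type*} [AddCommGroup V] (f g : E → V) {A : Set E} (X : Configuration d)
    (hb : Bornology.IsBounded A) :
    pointSum (fun z => f z - g z) A X = pointSum f A X - pointSum g A X := by
  simp_rw [pointSum_eq_sum _ X hb, Finset.sum_sub_distrib]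

/-- The partial force differences due to the points outside `A`. -/
noncomputable def outerForceDiff (A : Set E) (x y : E) (n : ℕ) (X : Configuration d) : E :=
  pointSum (fun z => coulombKernel d (x - z)) (Metric.ball x n \ A) X -
    pointSum (fun z => coulombKernel d (y - z)) (Metric.ball y n \ A) X

theorem measurable_kernel_sub (x : E) : Measurable fun z => coulombKernel d (x - z) :=
  coulombKernel.measurable.comp (measurable_const.sub measurable_id)

theorem measurable_outerForceDiff {A : Set E} (hm : MeasurableSet A) (x y : E) (n : ℕ) :
    Measurable[localSigma Aᶜ] (outerForceDiff A x y n) := by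
  have h : ∀ x : E, Measurable[localSigma Aᶜ] (fun X : Configuration d =>
      pointSum (fun z => coulombKernel d (x - z)) (Metric.ball x n \ A) X) := fun x =>
    measurable_pointSum_euclidean (Metric.isBounded_ball.subset Set.sdiff_subset)
      (Metric.isOpen_ball.measurableSet.diff hm) (fun _ hz => hz.2) (measurable_kernel_sub x)
  have h1 := h x
  have h2 := h y
  exact h1.sub h2

theorem partialForce_eq_add_of_subset {A : Set E} (X : Configuration d) (x : E) {R : ℝ}
    (hA : A ⊆ Metric.ball x R) :
    X.partialForce R x = pointSum (fun z => coulombKernel d (x - z)) (Metric.ball x R \ A) X +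
      pointSum (fun z => coulombKernel d (x - z)) A X := by
  rw [partialForce_eq_pointSum, ← pointSum_union _ _ (Metric.isBounded_ball.subset Set.sdiff_subset)
    (Metric.isBounded_ball.subset hA) Set.disjoint_sdiff_left, Set.sdiff_union_of_subset hA]
  rfl

theorem eventually_subset_ball {A : Set E} (hb : Bornology.IsBounded A) (x : E) :
    ∀ᶠ n : ℕ in atTop, A ⊆ Metric.ball x n := by
  obtain ⟨r, hr⟩ := hb.subset_ball x
  filter_upwards [eventually_ge_atTop ⌈r⌉₊] with n hn
  exact hr.trans (Metric.ball_subset_ball (Nat.ceil_le.1 hn))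

/-- Once both balls contain `A`, its contribution no longer depends on the radius. Integer radii
suffice, and a sequence keeps the limit measurable. -/
theorem tendsto_outerForceDiff {A : Set E} (hb : Bornology.IsBounded A) {X : Configuration d}
    {x y : E} (hx : X.ForceConverges x) (hy : X.ForceConverges y) :
    Tendsto (fun n => outerForceDiff A x y n X) atTop (𝓝 (X.force x - X.force y -
      pointSum (fun z => coulombKernel d (x - z) - coulombKernel d (y - z)) A X)) := by
  have h1 := (tendsto_nhds_limUnder hx).comp tendsto_natCast_atTop_atTop
  have h2 := (tendsto_nhds_limUnder hy).comp tendsto_natCast_atTop_atTop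
  refine ((h1.sub h2).sub_const _).congr' ?_
  filter_upwards [eventually_subset_ball hb x, eventually_subset_ball hb y] with n hnx hny
  rw [Function.comp_apply, Function.comp_apply, partialForce_eq_add_of_subset X x hnx,
    partialForce_eq_add_of_subset X y hny, pointSum_sub _ _ _ hb, outerForceDiff]
  abel

end Configuration

/-! ### Continuity of the force difference. -/

namespace IsHomogeneousPoissonProcess

open Configuration

variable {d : ℕ} {ρ : ℝ≥0} {ν : Measure (Configuration d)}

local notation "E" => EuclideanSpace ℝ (Fin d)

theorem measure_force_sub_eq_inter_count_eq_one (h : IsHomogeneousPoissonProcess ν ρ id)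
    [IsProbabilityMeasure ν] (hd : 2 ≤ d) {x y : E} (hxy : x ≠ y) (c : E) {A : Set E}
    (hb : Bornology.IsBounded A) (hm : MeasurableSet A) :
    ν {X | (X.ForceConverges x ∧ X.ForceConverges y ∧ X.force x - X.force y = c) ∧
      X.count A = 1} = 0 := by
  set f : E → E := fun z => coulombKernel d (x - z) - coulombKernel d (y - z) with hf
  have hfm : Measurable f := (measurable_kernel_sub x).sub (measurable_kernel_sub y)
  let U : Configuration d → ℕ × E := fun X => (X.count A, pointSum f A X)
  -- Measurable everywhere, thanks to the default value of `limUnder` where there is no limit.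
  let H : Configuration d → E := fun X => limUnder atTop fun n => outerForceDiff A x y n X
  have hU : Measurable[localSigma A] U :=
    (measurable_count_localSigma hb hm subset_rfl).prodMk
      (measurable_pointSum_euclidean hb hm subset_rfl hfm)
  have hH : Measurable[localSigma Aᶜ] H :=
    (@StronglyMeasurable.limUnder _ _ _ (localSigma Aᶜ) _ _ _ _ _ _ _ fun n =>
      (measurable_outerForceDiff hm x y n).stronglyMeasurable).measurable
  have hU' : Measurable U := hU.mono (localSigma_le _) le_rfl
  have hH' : Measurable H := hH.mono (localSigma_le _) le_rfl
  have hind : IndepFun H U ν := by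
    rw [IndepFun_iff_Indep]
    exact indep_of_indep_of_le_left (indep_of_indep_of_le_right
      (h.indep_localSigma disjoint_compl_left) hU.comap_le) hH.comap_le
  have hmap := (indepFun_iff_map_prod_eq_prod_map_map hH'.aemeasurable hU'.aemeasurable).1 hind
  let S : Set (E × ℕ × E) := {p | p.2.1 = 1 ∧ p.1 = c - p.2.2}
  have hS : MeasurableSet S :=
    (measurableSet_eq_fun (by fun_prop) (by fun_prop)).inter
      (measurableSet_eq_fun (by fun_prop) (by fun_prop))
  have hS0 : ν ((fun X => (H X, U X)) ⁻¹' S) = 0 := by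
    rw [← Measure.map_apply (hH'.prodMk hU') hS, hmap, Measure.measure_prod_null hS]
    refine Eventually.of_forall fun v => ?_
    refine (Measure.map_apply hU' (measurable_prodMk_left hS)).trans ?_
    -- With the outer value `v` frozen, the only point of `A` must lie in this null set.
    have h0 := h.ae_count_eq_zero (B := A ∩ f ⁻¹' {c - v}) (hb.subset Set.inter_subset_left)
      (hm.inter (hfm (measurableSet_singleton _)))
      (measure_mono_null Set.inter_subset_right (coulombKernel.volume_level_set hd hxy _))
    refine measure_mono_null (fun X hX => ?_) h0
    obtain ⟨hX1, hX2⟩ := hX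
    obtain ⟨z, hz⟩ := exists_of_count_eq_one hX1
    have hW : pointSum f A X = f z := pointSum_of_inter_eq_singleton f hz
    have hzm : z ∈ X.carrier ∩ A := hz ▸ Set.mem_singleton z
    have hfz : f z = c - v := by
      change v = c - pointSum f A X at hX2
      rw [← hW, hX2, sub_sub_cancel]
    exact (Set.ncard_ne_zero_of_mem (a := z) ⟨hzm.1, hzm.2, hfz⟩
      (X.locallyFinite _ (hb.subset Set.inter_subset_left)))
  refine measure_mono_null ?_ hS0
  rintro X ⟨⟨hx, hy, hc⟩, h1⟩
  refine ⟨h1, ?_⟩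
  have := (tendsto_outerForceDiff hb hx hy).limUnder_eq
  rw [hc] at this
  exact this

theorem measure_force_sub_eq (h : IsHomogeneousPoissonProcess ν ρ id)
    [IsProbabilityMeasure ν] (hρ : 0 < ρ) {x y : E} (hxy : x ≠ y) (c : E) :
    ν {X | X.ForceConverges x ∧ X.ForceConverges y ∧ X.force x - X.force y = c} = 0 := by
  have hd0 : d ≠ 0 := by
    rintro rfl
    exact hxy (Subsingleton.elim _ _)
  have hfreq := h.ae_frequently_count_shell_eq_one hρ hd0 x
  rcases (by omega : d = 1 ∨ 2 ≤ d) with rfl | hd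
  · refine measure_mono_null (fun X hX => ?_) hfreq
    exact fun hX' => not_forceConverges_of_frequently X x hX' hX.1
  · refine measure_mono_null (t := {X | ¬ ∃ᶠ n in atTop, X.count (shell x n) = 1} ∪
      ⋃ n, {X | (X.ForceConverges x ∧ X.ForceConverges y ∧ X.force x - X.force y = c) ∧
        X.count (shell x n) = 1}) (fun X hX => ?_) (measure_union_null hfreq
          (measure_iUnion_null fun n => h.measure_force_sub_eq_inter_count_eq_one hd hxy c
            (isBounded_shell x n) (measurableSet_shell x n)))
    by_cases hX' : ∃ᶠ n in atTop, X.count (shell x n) = 1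
    · obtain ⟨n, hn⟩ := hX'.exists
      exact Or.inr (Set.mem_iUnion.2 ⟨n, hX, hn⟩)
    · exact Or.inl hX'

end IsHomogeneousPoissonProcess

/-! ### Almost sure convergence of the force for `d ≥ 3`. -/

/-- A series of centered square-integrable increments, each independent of the past, converges
almost surely if the second moments are summable. -/
theorem ae_exists_tendsto_sum_of_indep {Ω : Type*} {m0 : MeasurableSpace Ω} {μ : Measure Ω}
    [IsProbabilityMeasure μ] (ℱ : Filtration ℕ m0) {Y : ℕ → Ω → ℝ}
    (hmeas : ∀ n, Measurable[ℱ (n + 1)] (Y n))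
    (hind : ∀ n, Indep (MeasurableSpace.comap (Y n) inferInstance) (ℱ n) μ)
    (hL2 : ∀ n, MemLp (Y n) 2 μ) (hzero : ∀ n, ∫ ω, Y n ω ∂μ = 0) {v : ℕ → ℝ}
    (hvar : ∀ n, ∫ ω, Y n ω ^ 2 ∂μ ≤ v n) (hv : Summable v) :
    ∀ᵐ ω ∂μ, ∃ c, Tendsto (fun n => ∑ k ∈ Finset.range n, Y k ω) atTop (𝓝 c) := by
  set M : ℕ → Ω → ℝ := fun n => ∑ k ∈ Finset.range n, Y k with hM
  have hMmeas : ∀ n, StronglyMeasurable[ℱ n] (M n) := fun n =>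
    Finset.stronglyMeasurable_sum _ fun k hk =>
      ((hmeas k).mono (ℱ.mono (Finset.mem_range.1 hk)) le_rfl).stronglyMeasurable
  have hML2 : ∀ n, MemLp (M n) 2 μ := fun n => memLp_finsetSum' _ fun k _ => hL2 k
  have hMint : ∀ n, Integrable (M n) μ := fun n => (hML2 n).integrable one_le_two
  have hsucc : ∀ n, M (n + 1) = M n + Y n := fun n => Finset.sum_range_succ _ _
  have hMzero : ∀ n, ∫ ω, M n ω ∂μ = 0 := by
    intro n
    simp only [hM, Finset.sum_apply]
    rw [integral_finsetSum _ fun k _ => (hL2 k).integrable one_le_two]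
    simp [hzero]
  have hmart : Martingale M ℱ μ := by
    refine martingale_of_condExp_sub_eq_zero_nat hMmeas hMint fun n => ?_
    rw [hsucc, add_sub_cancel_left]
    have h := condExp_indep_eq (f := Y n) ((hmeas n).comap_le.trans (ℱ.le _)) (ℱ.le n)
      (comap_measurable (Y n)).stronglyMeasurable (hind n)
    rw [hzero n] at h
    exact h
  have hsq : ∀ n, ∫ ω, M n ω ^ 2 ∂μ ≤ ∑' k, v k := by
    have hv0 : ∀ n, 0 ≤ v n := fun n => (integral_nonneg fun ω => sq_nonneg _).trans (hvar n)
    have hle : ∀ n, variance (M n) μ ≤ ∑ k ∈ Finset.range n, v k := by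
      intro n
      induction n with
      | zero => simp [hM]
      | succ n ih =>
        have hI : IndepFun (M n) (Y n) μ := by
          rw [IndepFun_iff_Indep]
          exact indep_of_indep_of_le_left (hind n).symm (hMmeas n).measurable.comap_le
        rw [hsucc, hI.variance_add (hML2 n) (hL2 n), Finset.sum_range_succ,
          variance_of_integral_eq_zero (hL2 n).aemeasurable (hzero n)]
        exact add_le_add ih (hvar n)
    intro n
    rw [← variance_of_integral_eq_zero (hML2 n).aemeasurable (hMzero n)]
    exact (hle n).trans (hv.sum_le_tsum _ fun k _ => hv0 k)
  have hbdd : ∀ n, eLpNorm (M n) 1 μ ≤ ((1 + ∑' k, v k).toNNReal : ℝ≥0∞) := by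
    intro n
    rw [eLpNorm_one_eq_lintegral_enorm, ← ofReal_integral_norm_eq_lintegral_enorm (hMint n)]
    refine ENNReal.ofReal_le_ofReal ?_
    have hint : Integrable (fun ω => 1 + M n ω ^ 2) μ :=
      (integrable_const 1).add (hML2 n).integrable_sq
    -- The `L²` bound is weakened to the `L¹` bound required by martingale convergence.
    calc ∫ ω, ‖M n ω‖ ∂μ ≤ ∫ ω, 1 + M n ω ^ 2 ∂μ := by
          refine integral_mono (hMint n).norm hint fun ω => ?_
          rw [Real.norm_eq_abs, ← sq_abs]
          nlinarith [sq_nonneg (|M n ω| - 1), abs_nonneg (M n ω)]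
      _ = 1 + ∫ ω, M n ω ^ 2 ∂μ := by
          rw [integral_add (integrable_const 1) (hML2 n).integrable_sq]
          simp
      _ ≤ 1 + ∑' k, v k := by
          gcongr
          exact hsq n
  filter_upwards [hmart.submartingale.ae_tendsto_limitProcess hbdd] with ω hω
  exact ⟨_, by simpa [hM] using hω⟩

/-- The maximum of the norm of the Coulomb kernel on the shell with index `n`. -/
noncomputable def shellBound (d n : ℕ) : ℝ := (shellRadius d n ^ (d - 1))⁻¹

theorem shellBound_nonneg (d n : ℕ) : 0 ≤ shellBound d n :=
  inv_nonneg.2 (pow_nonneg (shellRadius_pos n).le _)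

theorem summable_shellBound_sq {d : ℕ} (hd : 3 ≤ d) : Summable fun n => shellBound d n ^ 2 := by
  -- The exponent `2(d-1)/d` increases with `d` and equals `4/3` at `d = 3`; at `d = 2` it would be
  -- the critical value one.
  have hsum : Summable fun n : ℕ => ((n + 1 : ℕ) : ℝ) ^ (-(4 / 3) : ℝ) :=
    (summable_nat_add_iff 1).2 (Real.summable_nat_rpow.2 (by norm_num))
  refine Summable.of_nonneg_of_le (fun n => sq_nonneg _) (fun n => ?_) hsum
  have h1 : shellBound d n ^ 2 = ((n + 1 : ℕ) : ℝ) ^ (-((d : ℝ)⁻¹ * ((d - 1 : ℕ) * 2))) := by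
    rw [shellBound, shellRadius, inv_pow, ← pow_mul, Real.rpow_neg (by positivity),
      Real.rpow_mul (by positivity)]
    push_cast
    rw [← Real.rpow_natCast]
    push_cast
    rfl
  rw [h1]
  refine Real.rpow_le_rpow_of_exponent_le (by simp) ?_
  have hd' : (3 : ℝ) ≤ d := by exact_mod_cast hd
  rw [Nat.cast_sub (by omega), neg_le_neg_iff, inv_mul_eq_div, le_div_iff₀ (by linarith)]
  push_cast
  linarith

theorem norm_coulombKernel_le_shellBound {d : ℕ} (hd : 1 ≤ d) {x z : EuclideanSpace ℝ (Fin d)}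
    {n : ℕ} (hz : shellRadius d n ≤ dist z x) : ‖coulombKernel d (x - z)‖ ≤ shellBound d n := by
  have hnorm : shellRadius d n ≤ ‖x - z‖ := by rwa [← dist_eq_norm, dist_comm]
  have hpos := shellRadius_pos (d := d) n
  rw [coulombKernel.norm_eq hd _ (norm_pos_iff.1 (hpos.trans_le hnorm)), shellBound]
  gcongr

namespace Configuration

variable {d : ℕ}

local notation "E" => EuclideanSpace ℝ (Fin d)

theorem count_mono (X : Configuration d) {A B : Set E} (hb : Bornology.IsBounded B)
    (h : A ⊆ B) : X.count A ≤ X.count B :=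
  Set.ncard_le_ncard (Set.inter_subset_inter_right _ h) (X.locallyFinite _ hb)

theorem forceConverges_of_shells (hd : 1 ≤ d) {X : Configuration d} {x : E}
    (h0 : Tendsto (fun n => X.count (shell x n) * shellBound d n) atTop (𝓝 0))
    (hsum : ∀ i, ∃ c, Tendsto (fun n => ∑ k ∈ Finset.range n,
      pointSum (fun z => coulombKernel d (x - z) i) (shell x k) X) atTop (𝓝 c)) :
    X.ForceConverges x := by
  choose c hc using hsum
  have hvec : Tendsto (fun n => X.partialForce (shellRadius d n) x) atTop
      (𝓝 (X.partialForce (shellRadius d 0) x + WithLp.toLp 2 c)) := by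
    have h1 : Tendsto (fun n => WithLp.toLp 2 fun i => ∑ k ∈ Finset.range n,
        pointSum (fun z => coulombKernel d (x - z) i) (shell x k) X) atTop
        (𝓝 (WithLp.toLp 2 c)) :=
      ((PiLp.continuous_toLp 2 _).tendsto c).comp (tendsto_pi_nhds.2 hc)
    refine (h1.const_add _).congr fun n => ?_
    induction n with
    | zero =>
      ext i
      simp
    | succ n ih =>
      rw [partialForce_shell, ← ih, add_assoc]
      congr 1
      ext i
      simp [Finset.sum_range_succ, pointSum_apply _ X (isBounded_shell x n)]
  refine ⟨X.partialForce (shellRadius d 0) x + WithLp.toLp 2 c, ?_⟩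
  -- Index of the shell whose radii enclose `R`; the truncated subtraction is harmless for `R ≥ 1`.
  -- The error is at most the number of points in this shell times the kernel bound.
  let N : ℝ → ℕ := fun R => ⌊R ^ d⌋₊ - 1
  have hN : Tendsto N atTop atTop :=
    (tendsto_sub_atTop_nat 1).comp (tendsto_nat_floor_atTop.comp (tendsto_pow_atTop (by omega)))
  have hdiff : Tendsto (fun R => X.partialForce R x - X.partialForce (shellRadius d (N R)) x) atTop
      (𝓝 0) := by
    refine squeeze_zero_norm' ?_ (h0.comp hN)
    filter_upwards [eventually_ge_atTop 1] with R hR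
    have hfl : 1 ≤ ⌊R ^ d⌋₊ := Nat.floor_pos.2 (one_le_pow₀ hR)
    have hNR : ((N R : ℕ) : ℝ) + 1 = ⌊R ^ d⌋₊ := by
      have : N R + 1 = ⌊R ^ d⌋₊ := Nat.sub_add_cancel hfl
      exact_mod_cast this
    have hlow : shellRadius d (N R) ≤ R := by
      refine le_of_pow_le_pow_left₀ (by omega : d ≠ 0) (by linarith) ?_
      rw [shellRadius_pow (by omega), hNR]
      exact Nat.floor_le (by positivity)
    have hup : R < shellRadius d (N R + 1) := by
      refine lt_of_pow_lt_pow_left₀ d (shellRadius_pos _).le ?_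
      rw [shellRadius_pow (by omega)]
      push_cast
      rw [hNR]
      exact Nat.lt_floor_add_one _
    have hsub : Metric.ball x R \ Metric.ball x (shellRadius d (N R)) ⊆ shell x (N R) :=
      fun z hz => ⟨not_lt.1 hz.2, lt_trans hz.1 hup⟩
    have hb := (isBounded_shell x (N R)).subset hsub
    rw [partialForce_eq_add_of_subset X x (Metric.ball_subset_ball hlow),
      partialForce_eq_pointSum X (shellRadius d (N R))]
    change ‖_ + _ - pointSum (fun z => coulombKernel d (x - z)) _ X‖ ≤ _
    rw [add_sub_cancel_right]
    refine (norm_pointSum_le _ X hb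
      fun z hz => norm_coulombKernel_le_shellBound hd (hsub hz).1).trans ?_
    rw [Function.comp_apply]
    have := count_mono X (isBounded_shell x (N R)) hsub
    have := shellBound_nonneg d (N R)
    gcongr
  simpa using hdiff.add (hvec.comp hN)

end Configuration

namespace IsHomogeneousPoissonProcess

open Configuration

variable {d : ℕ} {ρ : ℝ≥0} {ν : Measure (Configuration d)}

local notation "E" => EuclideanSpace ℝ (Fin d)

theorem integrable_count_sq (h : IsHomogeneousPoissonProcess ν ρ id) {B : Set E}
    (hb : Bornology.IsBounded B) (hm : MeasurableSet B) :
    Integrable (fun X => (X.count B : ℝ) ^ 2) ν := by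
  have h1 := integrable_natCast_sq_poissonMeasure (ρ * (volume B).toNNReal)
  rw [← (h.hasLaw_count B hb hm).map_eq] at h1
  exact h1.comp_measurable (measurable_count hb hm)

theorem integral_count_sq (h : IsHomogeneousPoissonProcess ν ρ id) {B : Set E}
    (hb : Bornology.IsBounded B) (hm : MeasurableSet B) :
    ∫ X, (X.count B : ℝ) ^ 2 ∂ν =
      ∫ n : ℕ, (n : ℝ) ^ 2 ∂poissonMeasure (ρ * (volume B).toNNReal) :=
  (h.hasLaw_count B hb hm).integral_comp (f := fun n : ℕ => (n : ℝ) ^ 2)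
    (measurable_from_top.aestronglyMeasurable)

section Bounded

variable {A : Set (EuclideanSpace ℝ (Fin d))} {f : EuclideanSpace ℝ (Fin d) → ℝ} {C : ℝ}

theorem pointSum_sq_le (hb : Bornology.IsBounded A) (hC : ∀ z ∈ A, ‖f z‖ ≤ C)
    (X : Configuration d) : pointSum f A X ^ 2 ≤ (X.count A : ℝ) ^ 2 * C ^ 2 := by
  rw [← mul_pow, ← sq_abs]
  exact pow_le_pow_left₀ (abs_nonneg _) (norm_pointSum_le f X hb hC) 2

theorem memLp_pointSum (h : IsHomogeneousPoissonProcess ν ρ id) (hb : Bornology.IsBounded A)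
    (hm : MeasurableSet A) (hf : Measurable f) (hC : ∀ z ∈ A, ‖f z‖ ≤ C) :
    MemLp (pointSum f A) 2 ν := by
  have hmeas : Measurable (pointSum f A : Configuration d → ℝ) :=
    (measurable_pointSum hb hm subset_rfl hf).mono (localSigma_le A) le_rfl
  rw [memLp_two_iff_integrable_sq hmeas.aestronglyMeasurable]
  refine ((h.integrable_count_sq hb hm).mul_const (C ^ 2)).mono'
    (hmeas.pow_const 2).aestronglyMeasurable (Eventually.of_forall fun X => ?_)
  rw [Real.norm_of_nonneg (sq_nonneg _)]
  exact pointSum_sq_le hb hC X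

theorem integral_pointSum_sq_le (h : IsHomogeneousPoissonProcess ν ρ id)
    (hb : Bornology.IsBounded A) (hm : MeasurableSet A) (hf : Measurable f)
    (hC : ∀ z ∈ A, ‖f z‖ ≤ C) :
    ∫ X, pointSum f A X ^ 2 ∂ν ≤
      (∫ n : ℕ, (n : ℝ) ^ 2 ∂poissonMeasure (ρ * (volume A).toNNReal)) * C ^ 2 := by
  rw [← h.integral_count_sq hb hm, ← integral_mul_const]
  exact integral_mono (h.memLp_pointSum hb hm hf hC).integrable_sq
    ((h.integrable_count_sq hb hm).mul_const _) (pointSum_sq_le hb hC)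

/-- Campbell's formula for the positive and negative parts; boundedness of `f` makes both means
finite, so they cancel. -/
theorem integral_pointSum_eq_zero (h : IsHomogeneousPoissonProcess ν ρ id)
    (hb : Bornology.IsBounded A) (hm : MeasurableSet A) (hf : Measurable f)
    (hC : ∀ z ∈ A, ‖f z‖ ≤ C)
    (hsymm : ∫⁻ z in A, ENNReal.ofReal (-f z) = ∫⁻ z in A, ENNReal.ofReal (f z)) :
    ∫ X, pointSum f A X ∂ν = 0 := by
  have hfin : ∀ g : EuclideanSpace ℝ (Fin d) → ℝ, (∀ z ∈ A, ‖g z‖ ≤ C) →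
      (ρ : ℝ≥0∞) * ∫⁻ z in A, ENNReal.ofReal (g z) ≠ ∞ := by
    intro g hg
    refine ENNReal.mul_ne_top ENNReal.coe_ne_top (ne_top_of_le_ne_top ?_ (setLIntegral_mono' hm
      fun z hz => ENNReal.ofReal_le_ofReal ((le_abs_self _).trans (hg z hz))))
    rw [setLIntegral_const]
    exact ENNReal.mul_ne_top ENNReal.ofReal_ne_top hb.measure_lt_top.ne
  have key : ∀ g : EuclideanSpace ℝ (Fin d) → ℝ, Measurable g → (∀ z ∈ A, ‖g z‖ ≤ C) →
      Integrable (fun X => (∫⁻ z, ENNReal.ofReal (g z) ∂pointMeasure A X).toReal) ν ∧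
      ∫ X, (∫⁻ z, ENNReal.ofReal (g z) ∂pointMeasure A X).toReal ∂ν =
        (ρ * ∫⁻ z in A, ENNReal.ofReal (g z)).toReal := by
    intro g hg hgC
    have hmeas : Measurable fun X : Configuration d =>
        ∫⁻ z, ENNReal.ofReal (g z) ∂pointMeasure A X :=
      (measurable_lintegral_pointMeasure hb hm subset_rfl hg.ennreal_ofReal).mono
        (localSigma_le A) le_rfl
    have hL := h.lintegral_lintegral_pointMeasure hb hm hg.ennreal_ofReal
    have hne := hL.trans_ne (hfin g hgC)
    refine ⟨integrable_toReal_of_lintegral_ne_top hmeas.aemeasurable hne, ?_⟩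
    rw [integral_toReal hmeas.aemeasurable (ae_lt_top hmeas hne), hL]
  obtain ⟨hi, he⟩ := key f hf hC
  obtain ⟨hi', he'⟩ := key (fun z => -f z) hf.neg (by simpa using hC)
  simp_rw [pointSum_eq_toReal_sub f _ hb]
  rw [integral_sub hi hi', he, he', hsymm, sub_self]

end Bounded

/-- The reflection `z ↦ x + x - z` preserves volume and the shell, and the kernel is odd. -/
theorem setLIntegral_shell_neg_coulombKernel (x : E) (n : ℕ) (i : Fin d) :
    ∫⁻ z in shell x n, ENNReal.ofReal (-coulombKernel d (x - z) i) =
      ∫⁻ z in shell x n, ENNReal.ofReal (coulombKernel d (x - z) i) := by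
  have hmp := Measure.measurePreserving_sub_left (volume : Measure E) (x + x)
  have hmeas : Measurable fun z => ENNReal.ofReal (coulombKernel d (x - z) i) := by
    have := measurable_kernel_sub x
    fun_prop
  rw [← hmp.setLIntegral_comp_preimage (measurableSet_shell x n) hmeas]
  have hpre : (fun z => x + x - z) ⁻¹' shell x n = shell x n := by
    ext z
    have : dist (x + x - z) x = dist z x := by
      rw [dist_eq_norm, dist_comm, dist_eq_norm]
      congr 1
      abel
    simp only [shell, Set.mem_preimage, this]
  rw [hpre]
  refine lintegral_congr fun z => ?_
  have : x - (x + x - z) = -(x - z) := by abel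
  rw [this, coulombKernel.neg, PiLp.neg_apply]

/-- The squares have summable means, so their sum is almost surely finite and its terms tend to
zero. -/
theorem ae_tendsto_count_mul_shellBound (h : IsHomogeneousPoissonProcess ν ρ id) (hd : 3 ≤ d)
    (x : E) :
    ∀ᵐ X ∂ν, Tendsto (fun n => X.count (shell x n) * shellBound d n) atTop (𝓝 0) := by
  have hmeas : ∀ n, Measurable fun X : Configuration d =>
      ENNReal.ofReal ((X.count (shell x n) * shellBound d n) ^ 2) := fun n =>
    (measurable_from_top (f := fun m : ℕ => ENNReal.ofReal ((m * shellBound d n) ^ 2))).comp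
      (measurable_count (isBounded_shell x n) (measurableSet_shell x n))
  have hint : ∀ n, ∫⁻ X, ENNReal.ofReal ((X.count (shell x n) * shellBound d n) ^ 2) ∂ν =
      ENNReal.ofReal ((∫ n : ℕ, (n : ℝ) ^ 2 ∂poissonMeasure
        (ρ * (volume (Metric.ball (0 : E) 1)).toNNReal)) * shellBound d n ^ 2) := by
    intro n
    simp_rw [mul_pow]
    rw [← ofReal_integral_eq_lintegral_ofReal
      ((h.integrable_count_sq (isBounded_shell x n) (measurableSet_shell x n)).mul_const _)
      (Eventually.of_forall fun X => by positivity), integral_mul_const,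
      h.integral_count_sq (isBounded_shell x n) (measurableSet_shell x n),
      volume_shell x (by omega)]
  have hfin : ∫⁻ X, ∑' n, ENNReal.ofReal ((X.count (shell x n) * shellBound d n) ^ 2) ∂ν ≠ ∞ := by
    rw [lintegral_tsum fun n => (hmeas n).aemeasurable]
    simp_rw [hint]
    exact ((summable_shellBound_sq hd).mul_left _).tsum_ofReal_ne_top
  filter_upwards [ae_lt_top (Measurable.tsum hmeas) hfin] with X hX
  have h1 := ENNReal.tendsto_atTop_zero_of_tsum_ne_top hX.ne
  have h2 := (ENNReal.tendsto_toReal ENNReal.zero_ne_top).comp h1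
  have h3 := h2.sqrt
  simp only [Function.comp_def, ENNReal.toReal_zero, Real.sqrt_zero] at h3
  refine h3.congr fun n => ?_
  rw [ENNReal.toReal_ofReal (sq_nonneg _),
    Real.sqrt_sq (mul_nonneg (by positivity) (shellBound_nonneg d n))]

/-- The filtration generated by the configuration in the balls of radii `shellRadius d n`. -/
noncomputable def shellFiltration (x : E) :
    Filtration ℕ (instMeasurableSpace : MeasurableSpace (Configuration d)) where
  seq n := localSigma (Metric.ball x (shellRadius d n))
  mono' _ _ hmn := localSigma_mono (Metric.ball_subset_ball (shellRadius_mono hmn))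
  le' _ := localSigma_le _

theorem measurable_kernel_sub_apply (x : E) (i : Fin d) :
    Measurable fun z => coulombKernel d (x - z) i := by
  have := measurable_kernel_sub x
  fun_prop

theorem norm_kernel_apply_le_shellBound (hd : 1 ≤ d) (x : E) (i : Fin d) (n : ℕ) :
    ∀ z ∈ shell x n, ‖coulombKernel d (x - z) i‖ ≤ shellBound d n := fun _ hz =>
  (PiLp.norm_apply_le _ i).trans (norm_coulombKernel_le_shellBound hd hz.1)

theorem measurable_pointSum_shell {f : E → ℝ} (hf : Measurable f) (x : E) (n : ℕ) :
    Measurable[shellFiltration x (n + 1)] (pointSum f (shell x n)) :=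
  measurable_pointSum (isBounded_shell x n) (measurableSet_shell x n) (shell_subset_ball x n) hf

theorem indep_pointSum_shell (h : IsHomogeneousPoissonProcess ν ρ id) [IsProbabilityMeasure ν]
    {f : E → ℝ} (hf : Measurable f) (x : E) (n : ℕ) :
    Indep (MeasurableSpace.comap (pointSum f (shell x n)) inferInstance)
      (shellFiltration x n) ν :=
  indep_of_indep_of_le_left (h.indep_localSigma (disjoint_ball_shell x n)).symm
    (measurable_pointSum (isBounded_shell x n) (measurableSet_shell x n) subset_rfl hf).comap_le

theorem integral_pointSum_shell_sq_le (h : IsHomogeneousPoissonProcess ν ρ id) (hd : 1 ≤ d)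
    (x : E) (i : Fin d) (n : ℕ) :
    ∫ X, pointSum (fun z => coulombKernel d (x - z) i) (shell x n) X ^ 2 ∂ν ≤
      (∫ n : ℕ, (n : ℝ) ^ 2 ∂poissonMeasure (ρ * (volume (Metric.ball (0 : E) 1)).toNNReal)) *
        shellBound d n ^ 2 := by
  rw [← volume_shell x (by omega) n]
  exact h.integral_pointSum_sq_le (isBounded_shell x n) (measurableSet_shell x n)
    (measurable_kernel_sub_apply x i) (norm_kernel_apply_le_shellBound hd x i n)

theorem ae_exists_tendsto_sum_shell (h : IsHomogeneousPoissonProcess ν ρ id)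
    [IsProbabilityMeasure ν] (hd : 3 ≤ d) (x : E) (i : Fin d) :
    ∀ᵐ X ∂ν, ∃ c, Tendsto (fun n => ∑ k ∈ Finset.range n,
      pointSum (fun z => coulombKernel d (x - z) i) (shell x k) X) atTop (𝓝 c) := by
  have hd1 : 1 ≤ d := by omega
  have hf := measurable_kernel_sub_apply x i
  have hC := norm_kernel_apply_le_shellBound hd1 x i
  exact ae_exists_tendsto_sum_of_indep (shellFiltration x) (measurable_pointSum_shell hf x)
    (h.indep_pointSum_shell hf x)
    (fun n => h.memLp_pointSum (isBounded_shell x n) (measurableSet_shell x n) hf (hC n))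
    (fun n => h.integral_pointSum_eq_zero (isBounded_shell x n) (measurableSet_shell x n) hf (hC n)
      (setLIntegral_shell_neg_coulombKernel x n i))
    (h.integral_pointSum_shell_sq_le hd1 x i) ((summable_shellBound_sq hd).mul_left _)

theorem ae_forceConverges (h : IsHomogeneousPoissonProcess ν ρ id)
    [IsProbabilityMeasure ν] (hd : 3 ≤ d) (x : E) : ∀ᵐ X ∂ν, X.ForceConverges x := by
  filter_upwards [h.ae_tendsto_count_mul_shellBound hd x,
    ae_all_iff.2 (h.ae_exists_tendsto_sum_shell hd x)] with X h0 hsum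
  exact forceConverges_of_shells (by omega) h0 hsum

end IsHomogeneousPoissonProcess

theorem proposition4 {d : ℕ} {Ω : Type*} [MeasurableSpace Ω] (μ : Measure Ω)
    [IsProbabilityMeasure μ] (ρ : ℝ≥0) (hρ : 0 < ρ) (P : Ω → Configuration d)
    (hP : IsHomogeneousPoissonProcess μ ρ P)
    (x y : EuclideanSpace ℝ (Fin d)) (hxy : x ≠ y) :
    (3 ≤ d → ∀ᵐ ω ∂μ, (P ω).ForceConverges x ∧ (P ω).ForceConverges y) ∧
    ∀ c : EuclideanSpace ℝ (Fin d),
      μ {ω | (P ω).ForceConverges x ∧ (P ω).ForceConverges y ∧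
        (P ω).force x - (P ω).force y = c} = 0 := by
  have : IsProbabilityMeasure (μ.map P) :=
    Measure.isProbabilityMeasure_map hP.measurable.aemeasurable
  have h := hP.map_id
  refine ⟨fun hd => ?_, fun c => ?_⟩
  · exact ae_of_ae_map hP.measurable.aemeasurable
      ((h.ae_forceConverges hd x).and (h.ae_forceConverges hd y))
  -- This inequality holds for arbitrary sets, so measurability of the event is not needed.
  · exact le_antisymm ((Measure.le_map_apply hP.measurable.aemeasurable _).trans
      (h.measure_force_sub_eq hρ hxy c).le) zero_le
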